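/- Let $G$ be a compact Lie group with normalised Haar measure $\mu_G$, let $\widehat G$ be the set of equivalence classes of irreducible unitary representations $\pi:G\to U(d_\pi)$, with characters $\chi_\pi=\operatorname{trace}\pi$, and put $$\hat\phi(\pi)=\int_G\phi(g)\,\pi(g)^*\,d\mu_G(g),\qquad (\phi*\psi)(g)=\int_G\phi(h)\psi(h^{-1}g)\,d\mu_G(h),\qquad \check\phi(g)=\overline{\phi(g^{-1})}.$$ Let $\widehat G_+\subset\widehat G$ be co-finite, and let $t\mapsto p_t$ be a family in $C^1(\mathbb R_+;L^1(G))$, $\mathbb R_+=(0,\infty)$, which is a diffusive approximate identity with respect to $\widehat G_+$, that is: 1. $\|\hat p_t(\pi)\|\le C$ uniformly in $\pi\in\widehat G$ and $t>0$ (operator norm for the Euclidean norm); 2. $\lim_{t\to0}\hat p_t(\pi)=I$ for all $\pi\in\widehat G$; 3. $\lim_{t\to\infty}\hat p_t(\pi)=0$ for all $\pi\in\widehat G_+$; 4. $-\partial_t\hat p_t(\pi)$ is positive semidefinite for all $t>0$ and $\pi\in\widehat G_+$. Let $L^2_0(G)=\bigoplus_{\pi\in\widehat G_+}\mathcal H_\pi\subset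 L^2(G)$ be the Hilbert sum of the spaces $\mathcal H_\pi=\{g\mapsto\operatorname{trace}(\pi(g)A):A\in\mathbb C^{d_\pi\times d_\pi}\}$, and let $\phi|_{\widehat G_+}=\phi-\sum_{\pi\notin\widehat G_+}d_\pi\,\phi*\chi_\pi$ denote the projection of a function $\phi\in L^1(G)$. Let $\alpha(\rho)>0$ be a measurable weight on $\mathbb R_+$, and let $\rho\mapsto\psi_\rho\in L^2_0(G)$, $\rho>0$, be a (strongly measurable) diffusive wavelet family, that is, for all $t>0$, $$p_t\big|_{\widehat G_+}=\int_t^\infty\check\psi_\rho*\psi_\rho\;\alpha(\rho)\,d\rho,$$ where it suffices that this identity holds weakly: for each continuous $f$ on $G$, the function $\rho\mapsto\alpha(\rho)\int_G(\check\psi_\rho*\psi_\rho)f\,d\mu_G$ is integrable on $(t,T]$ for all $T>t$, and its integral over $(t,T]$ tends to $\int_G p_t|_{\widehat G_+}f\,d\mu_G$ as $T\to\infty$. Then the wavelet transform $\mathscr W\phi(\rho,\cdot)=\phi*\check\psi_\rho$ defines a linear map $$\mathscr W:L^2_0(G)\to L^2\big(\mathbb R_+\times G,\ \alpha(\rho)\,d\rho\otimes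 d\mu_G\big)$$ which is unitary in the sense that it preserves inner products: $\langle\mathscr W\phi_1,\mathscr W\phi_2\rangle=\langle\phi_1,\phi_2\rangle$ for all $\phi_1,\phi_2\in L^2_0(G)$. In particular, it is unitary onto its range. -/

import Mathlib

open MeasureTheory Filter Topology Set
open scoped ComplexOrder Manifold ContDiff Matrix ENNReal InnerProductSpace

noncomputable section

namespace DiffusiveWavelet

/-! ### Irreducible unitary representations and the dual of a group -/

/-- A (nonzero, finite-dimensional, continuous) irreducible unitary representation
`G → U(d)`: only the scalar matrices commute with all `π(g)`. -/
structure IrrRep (G : Type*) [Group G] [TopologicalSpace G] where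
  /-- the dimension of the representation -/
  dim : ℕ
  dim_pos : 0 < dim
  /-- the homomorphism into the unitary matrices -/
  hom : G →* Matrix.unitaryGroup (Fin dim) ℂ
  continuous_hom : Continuous hom
  irreducible : ∀ A : Matrix (Fin dim) (Fin dim) ℂ,
    (∀ g : G, (hom g : Matrix (Fin dim) (Fin dim) ℂ) * A = A * (hom g)) → ∃ c : ℂ, A = c • 1

section Dual

variable {G : Type*} [Group G] [TopologicalSpace G]

/-- The matrix `π(g)`. -/
def IrrRep.mat (π : IrrRep G) (g : G) : Matrix (Fin π.dim) (Fin π.dim) ℂ := π.hom g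

/-- The character `χ_π(g) = trace π(g)`. -/
def IrrRep.character (π : IrrRep G) (g : G) : ℂ := (π.mat g).trace

/-- Equivalence of representations: there is an invertible matrix `A` (with inverse `B`) such that
`π(g) A = A σ(g)` for all `g`. -/
def IrrRep.Equivalent (π σ : IrrRep G) : Prop :=
  ∃ (A : Matrix (Fin π.dim) (Fin σ.dim) ℂ) (B : Matrix (Fin σ.dim) (Fin π.dim) ℂ),
    A * B = 1 ∧ B * A = 1 ∧ ∀ g : G, π.mat g * A = A * σ.mat g

theorem IrrRep.Equivalent.refl (π : IrrRep G) : π.Equivalent π :=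
  ⟨1, 1, by simp, by simp, by simp⟩

theorem IrrRep.Equivalent.symm {π σ : IrrRep G} (h : π.Equivalent σ) : σ.Equivalent π := by
  obtain ⟨A, B, hAB, hBA, h⟩ := h
  refine ⟨B, A, hBA, hAB, fun g => ?_⟩
  calc σ.mat g * B = (B * A) * σ.mat g * B := by rw [hBA, Matrix.one_mul]
    _ = B * (A * σ.mat g) * B := by rw [Matrix.mul_assoc B A]
    _ = B * (π.mat g * A) * B := by rw [h g]
    _ = B * π.mat g * (A * B) := by simp only [Matrix.mul_assoc]
    _ = B * π.mat g := by rw [hAB, Matrix.mul_one]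

theorem IrrRep.Equivalent.trans {π σ τ : IrrRep G} (h : π.Equivalent σ) (h' : σ.Equivalent τ) :
    π.Equivalent τ := by
  obtain ⟨A, B, hAB, hBA, h⟩ := h
  obtain ⟨C, D, hCD, hDC, h'⟩ := h'
  refine ⟨A * C, D * B, ?_, ?_, fun g => ?_⟩
  · calc A * C * (D * B) = A * (C * D) * B := by simp only [Matrix.mul_assoc]
      _ = 1 := by rw [hCD, Matrix.mul_one, hAB]
  · calc D * B * (A * C) = D * (B * A) * C := by simp only [Matrix.mul_assoc]
      _ = 1 := by rw [hBA, Matrix.mul_one, hDC]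
  · rw [← Matrix.mul_assoc, h g, Matrix.mul_assoc, h' g, Matrix.mul_assoc]

variable (G) in
/-- Equivalence of irreducible unitary representations as a setoid. -/
def IrrRep.setoid : Setoid (IrrRep G) where
  r := IrrRep.Equivalent
  iseqv := ⟨IrrRep.Equivalent.refl, IrrRep.Equivalent.symm, IrrRep.Equivalent.trans⟩

variable (G) in
/-- The dual `Ĝ`: the set of equivalence classes of irreducible unitary representations. -/
def UnitaryDual : Type _ := Quotient (IrrRep.setoid G)

/-- The class in `Ĝ` of an irreducible unitary representation. -/
def IrrRep.cls (π : IrrRep G) : UnitaryDual G := Quotient.mk (IrrRep.setoid G) π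

/-- A representative of a class. -/
def UnitaryDual.rep (ξ : UnitaryDual G) : IrrRep G := Quotient.out (s := IrrRep.setoid G) ξ

end Dual

/-! ### Convolution, involution, Fourier coefficients -/

section Analysis

variable {G : Type*} [Group G] [TopologicalSpace G] [MeasurableSpace G]

/-- Convolution `(φ * ψ)(g) = ∫ φ(h) ψ(h⁻¹ g) dμ(h)`. -/
def conv (μ : Measure G) (φ ψ : G → ℂ) (g : G) : ℂ := ∫ h, φ h * ψ (h⁻¹ * g) ∂μ

/-- The involution `φ̌(g) = conj (φ(g⁻¹))`. -/
def invol (φ : G → ℂ) (g : G) : ℂ := star (φ g⁻¹)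

/-- The matrix-valued Fourier coefficient `φ̂(π) = ∫ φ(g) π(g)* dμ(g)` (taken entrywise). -/
def fourierCoeff (μ : Measure G) (φ : G → ℂ) (π : IrrRep G) :
    Matrix (Fin π.dim) (Fin π.dim) ℂ :=
  Matrix.of fun i j => ∫ g, φ g * (π.mat g)ᴴ i j ∂μ

/-- The subspace `H_π = {g ↦ trace (π(g) A)}` of `L²(G)`. -/
def coeffSpace (μ : Measure G) (π : IrrRep G) : Submodule ℂ (Lp ℂ 2 μ) where
  carrier := {f | ∃ A : Matrix (Fin π.dim) (Fin π.dim) ℂ,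
    (f : G → ℂ) =ᵐ[μ] fun g => (π.mat g * A).trace}
  add_mem' := by
    rintro f₁ f₂ ⟨A, hA⟩ ⟨B, hB⟩
    refine ⟨A + B, ?_⟩
    filter_upwards [Lp.coeFn_add f₁ f₂, hA, hB] with g h h₁ h₂
    rw [h, Pi.add_apply, h₁, h₂, Matrix.mul_add, Matrix.trace_add]
  zero_mem' := by
    refine ⟨0, ?_⟩
    filter_upwards [Lp.coeFn_zero ℂ 2 μ] with g h
    rw [h]
    simp
  smul_mem' := by
    rintro c f ⟨A, hA⟩
    refine ⟨c • A, ?_⟩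
    filter_upwards [Lp.coeFn_smul c f, hA] with g h h₁
    rw [h, Pi.smul_apply, h₁, Matrix.mul_smul, Matrix.trace_smul]

/-- For `S ⊆ Ĝ`, the Hilbert sum of the spaces `H_π` with `π ∈ S`, realised as the closed linear
span of these (mutually orthogonal) subspaces of `L²(G)`. For `S = Ĝ₊` this is `L²₀(G)`. -/
def L2Zero (μ : Measure G) (S : Set (UnitaryDual G)) : Submodule ℂ (Lp ℂ 2 μ) :=
  (⨆ π : {π : IrrRep G // π.cls ∈ S}, coeffSpace μ π.1).topologicalClosure

/-- The restriction `φ|_S` of an integrable function to a set `S ⊆ Ĝ` with finite complement. As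
`φ ↦ d_π φ * χ_π` is the projection onto `H_π`, one subtracts these projections for the finitely
many classes outside `S`; on `L²(G)` this is the orthogonal projection onto `L2Zero μ S`. -/
def restrictTo (μ : Measure G) (S : Set (UnitaryDual G)) (φ : G → ℂ) (g : G) : ℂ :=
  φ g - ∑ᶠ ξ ∈ Sᶜ, (ξ.rep.dim : ℂ) * conv μ φ ξ.rep.character g

/-! ### Diffusive approximate identities and diffusive wavelets -/

/-- `t ↦ p_t` is a diffusive approximate identity with respect to the co-finite set `S ⊆ Ĝ`.
Here `ℝ₊ = (0, ∞)`, and "positive matrix" means positive semidefinite. -/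
structure IsDiffusiveApproximateIdentity (μ : Measure G) [IsFiniteMeasure μ] (S : Set (UnitaryDual G))
    (p : ℝ → Lp ℂ 1 μ) : Prop where
  cofinite : Sᶜ.Finite
  contDiffOn : ContDiffOn ℝ 1 p (Ioi 0)
  /-- uniform boundedness in the operator norm induced by the Euclidean norm -/
  bounded : ∃ C : ℝ, ∀ (π : IrrRep G) (t : ℝ), 0 < t →
    ‖Matrix.toEuclideanCLM (𝕜 := ℂ) (n := Fin π.dim) (fourierCoeff μ (p t) π)‖ ≤ C
  tendsto_one : ∀ π : IrrRep G,
    Tendsto (fun t => fourierCoeff μ (p t) π) (𝓝[>] 0) (𝓝 1)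
  tendsto_zero : ∀ π : IrrRep G, π.cls ∈ S →
    Tendsto (fun t => fourierCoeff μ (p t) π) atTop (𝓝 0)
  neg_deriv_pos : ∀ π : IrrRep G, π.cls ∈ S → ∀ t : ℝ, 0 < t →
    (-(Matrix.of fun i j => deriv (fun s => fourierCoeff μ (p s) π i j) t)).PosSemidef

/-- `ψ_ρ`, `ρ > 0`, is a diffusive wavelet family for `p` and the weight `α`. The admissibility
condition `p_t|_S = ∫_t^∞ ψ̌_ρ * ψ_ρ α(ρ) dρ` is required in the weak sense only, i.e. after
integration against each continuous function `f` on `G`, and with the upper limit of the integral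
taken as an improper one. -/
structure IsDiffusiveWaveletFamily (μ : Measure G) [IsFiniteMeasure μ] (S : Set (UnitaryDual G))
    (p : ℝ → Lp ℂ 1 μ) (α : ℝ → ℝ) (ψ : ℝ → Lp ℂ 2 μ) : Prop where
  weight_pos : ∀ ρ, 0 < ρ → 0 < α ρ
  weight_measurable : AEMeasurable α (volume.restrict (Ioi 0))
  measurable : AEStronglyMeasurable ψ (volume.restrict (Ioi 0))
  mem : ∀ ρ, 0 < ρ → ψ ρ ∈ L2Zero μ S
  admissible : ∀ t : ℝ, 0 < t → ∀ f : C(G, ℂ),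
    (∀ T, t < T → IntervalIntegrable
      (fun ρ => (∫ g, conv μ (invol (ψ ρ)) (ψ ρ) g * f g ∂μ) * (α ρ : ℂ)) volume t T) ∧
    Tendsto (fun T => ∫ ρ in t..T, (∫ g, conv μ (invol (ψ ρ)) (ψ ρ) g * f g ∂μ) * (α ρ : ℂ))
      atTop (𝓝 (∫ g, restrictTo μ S (p t) g * f g ∂μ))

/-- The wavelet transform `𝒲φ(ρ, g) = (φ * ψ̌_ρ)(g)`. -/
def waveletTransform (μ : Measure G) (ψ : ℝ → Lp ℂ 2 μ) (φ : Lp ℂ 2 μ) (x : ℝ × G) : ℂ :=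
  conv μ φ (invol (ψ x.1)) x.2

/-- The measure `α(ρ) dρ` on `ℝ₊ = (0, ∞)`. -/
def scaleMeasure (α : ℝ → ℝ) : Measure ℝ :=
  (volume.restrict (Ioi 0)).withDensity fun ρ => ENNReal.ofReal (α ρ)

end Analysis

end DiffusiveWavelet

end

open DiffusiveWavelet

/-!
With `(L_g u)(h) = u(gh)` and `(R_x u)(h) = u(hx)`, a wavelet `v` at a fixed scale satisfies
`(u * v̌)(g) = ⟪v, L_g u⟫` and `(v̌ * v)(x) = ⟪v, R_x v⟫`, and Fubini gives
`∫ ⟪v, R_x v⟫ ⟪R_x u, u⟫ dx = ∫ |⟪v, L_g u⟫|² dg`.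
Hence testing the admissibility condition against `f(x) = ⟪R_x u, u⟫` computes the energy of `𝒲u`
at the scales `ρ > t` as `∫ p_t|_S f dμ`. If `u` is a finite sum of elements of the spaces `H_π`,
`π ∈ S`, then `f` is a finite sum of functions `trace (π(x)* B)`, so `p̂_t(π) → 1` makes this
integral tend to `f(1) = ‖u‖²` as `t → 0`. By density, `𝒲` is isometric on `L²₀(G)`.
-/

noncomputable section

namespace DiffusiveWavelet

section CompactGroup

variable {G : Type*} [Group G] [TopologicalSpace G] [IsTopologicalGroup G] [CompactSpace G]
  [MeasurableSpace G] [BorelSpace G]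

theorem eq_of_measure_univ_eq {μ ν : Measure G} [μ.IsHaarMeasure] [ν.IsMulLeftInvariant]
    (h : ν univ = μ univ) : ν = μ := by
  have : IsFiniteMeasure ν := ⟨h ▸ measure_lt_top μ univ⟩
  have hν : ν = ν.haarScalarFactor μ • μ := Measure.isMulInvariant_eq_smul_of_compactSpace ν μ
  have hmass : (ν.haarScalarFactor μ : ℝ≥0∞) * μ univ = 1 * μ univ :=
    calc (ν.haarScalarFactor μ : ℝ≥0∞) * μ univ = ν univ := (congrArg (· univ) hν).symm
      _ = 1 * μ univ := by rw [h, one_mul]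
  have hfactor : ν.haarScalarFactor μ = 1 := by
    exact_mod_cast (ENNReal.mul_left_inj (NeZero.ne _) (measure_ne_top μ univ)).mp hmass
  rw [hν, hfactor, one_smul]

variable (μ : Measure G) [μ.IsHaarMeasure]

instance isMulRightInvariant_of_compactSpace : μ.IsMulRightInvariant where
  map_mul_right_eq_self g :=
    eq_of_measure_univ_eq (Measure.map_apply (measurable_mul_const g) .univ)

instance isInvInvariant_of_compactSpace : μ.IsInvInvariant where
  inv_eq_self := eq_of_measure_univ_eq (by rw [Measure.inv_apply, inv_univ])

end CompactGroup

section CompactSpace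

variable {G F : Type*} [TopologicalSpace G] [CompactSpace G] [MeasurableSpace G] [BorelSpace G]
  [NormedAddCommGroup F] [NormedSpace ℝ F]

theorem integrable_mul_continuous {μ : Measure G} {φ f : G → ℂ} (hφ : Integrable φ μ)
    (hf : Continuous f) : Integrable (fun g => φ g * f g) μ := by
  obtain ⟨C, hC⟩ := (isCompact_range hf).isBounded.exists_norm_le
  exact hφ.mul_bdd hf.aestronglyMeasurable (.of_forall fun g => hC _ ⟨g, rfl⟩)

variable (μ : Measure G) [IsFiniteMeasureOnCompacts μ]

theorem continuous_integral_of_compactSpace {X : Type*} [TopologicalSpace X] {f : X → G → F}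
    (hf : Continuous f.uncurry) : Continuous fun x => ∫ g, f x g ∂μ := by
  rw [← continuousOn_univ]
  exact continuousOn_integral_of_compact_support isCompact_univ hf.continuousOn (by simp)

theorem integral_swap_of_continuous {f : G → G → F} (hf : Continuous f.uncurry) :
    ∫ x, ∫ y, f x y ∂μ ∂μ = ∫ y, ∫ x, f x y ∂μ ∂μ :=
  integral_integral_swap_of_hasCompactSupport hf (HasCompactSupport.of_compactSpace _)

end CompactSpace

section Translation

variable {G : Type*} [Group G] [MeasurableSpace G] [MeasurableMul G] (μ : Measure G)

/-- Left translation `(L_g φ)(h) = φ(gh)` on `L²(G)`. -/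
def leftTranslate [μ.IsMulLeftInvariant] (g : G) : Lp ℂ 2 μ →ₗᵢ[ℂ] Lp ℂ 2 μ :=
  Lp.compMeasurePreservingₗᵢ ℂ (g * ·) (measurePreserving_mul_left μ g)

/-- Right translation `(R_x φ)(h) = φ(hx)` on `L²(G)`. -/
def rightTranslate [μ.IsMulRightInvariant] (x : G) : Lp ℂ 2 μ →ₗᵢ[ℂ] Lp ℂ 2 μ :=
  Lp.compMeasurePreservingₗᵢ ℂ (· * x) (measurePreserving_mul_right μ x)

theorem leftTranslate_ae_eq [μ.IsMulLeftInvariant] (g : G) (φ : Lp ℂ 2 μ) :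
    leftTranslate μ g φ =ᵐ[μ] fun h => φ (g * h) :=
  Lp.coeFn_compMeasurePreserving _ _

theorem rightTranslate_ae_eq [μ.IsMulRightInvariant] (x : G) (φ : Lp ℂ 2 μ) :
    rightTranslate μ x φ =ᵐ[μ] fun h => φ (h * x) :=
  Lp.coeFn_compMeasurePreserving _ _

theorem rightTranslate_one [μ.IsMulRightInvariant] (φ : Lp ℂ 2 μ) :
    rightTranslate μ 1 φ = φ := by
  refine Lp.ext ?_
  simpa only [mul_one] using rightTranslate_ae_eq μ 1 φ

theorem waveletTransform_eq_inner [μ.IsMulLeftInvariant] (ψ : ℝ → Lp ℂ 2 μ) (φ : Lp ℂ 2 μ)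
    (y : ℝ × G) : waveletTransform μ ψ φ y = ⟪ψ y.1, leftTranslate μ y.2 φ⟫_ℂ := by
  rw [waveletTransform, conv, L2.inner_def,
    ← integral_mul_left_eq_self (fun h => φ h * invol (ψ y.1) (h⁻¹ * y.2)) y.2]
  refine integral_congr_ae ?_
  filter_upwards [leftTranslate_ae_eq μ y.2 φ] with h hh
  simp [hh, invol, RCLike.inner_apply]

theorem conv_invol_eq_inner [MeasurableInv G] [μ.IsMulRightInvariant] [μ.IsInvInvariant]
    (u v : Lp ℂ 2 μ) (x : G) :
    conv μ (invol u) v x = ⟪u, rightTranslate μ x v⟫_ℂ := by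
  rw [conv, L2.inner_def, ← integral_inv_eq_self]
  refine integral_congr_ae ?_
  filter_upwards [rightTranslate_ae_eq μ x v] with h hh
  simp [hh, invol, RCLike.inner_apply, mul_comm]

end Translation

section Plancherel

variable {G : Type*} [Group G] [TopologicalSpace G] [IsTopologicalGroup G] [CompactSpace G]
  [MeasurableSpace G] [BorelSpace G] (μ : Measure G) [μ.IsHaarMeasure]

theorem continuous_leftTranslate :
    Continuous fun y : G × Lp ℂ 2 μ => leftTranslate μ y.1 y.2 :=
  continuous_snd.compMeasurePreservingLp
    ((ContinuousMap.curry ⟨fun z : G × G => z.1 * z.2, continuous_mul⟩).continuous.comp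
      continuous_fst)
    (fun y => measurePreserving_mul_left μ y.1) ENNReal.ofNat_ne_top

theorem continuous_rightTranslate :
    Continuous fun y : G × Lp ℂ 2 μ => rightTranslate μ y.1 y.2 :=
  continuous_snd.compMeasurePreservingLp
    ((ContinuousMap.curry ⟨fun z : G × G => z.2 * z.1, by fun_prop⟩).continuous.comp
      continuous_fst)
    (fun y => measurePreserving_mul_right μ y.1) ENNReal.ofNat_ne_top

theorem leftTranslate_toLp (g : G) (f : C(G, ℂ)) :
    leftTranslate μ g (ContinuousMap.toLp 2 μ ℂ f) =
      ContinuousMap.toLp 2 μ ℂ (f.comp (.mulLeft g)) :=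
  rfl

theorem rightTranslate_toLp (x : G) (f : C(G, ℂ)) :
    rightTranslate μ x (ContinuousMap.toLp 2 μ ℂ f) =
      ContinuousMap.toLp 2 μ ℂ (f.comp (.mulRight x)) :=
  rfl

theorem integral_inner_rightTranslate_mul_toLp (f k : C(G, ℂ)) :
    let u := ContinuousMap.toLp 2 μ ℂ f
    let v := ContinuousMap.toLp 2 μ ℂ k
    ∫ x, ⟪v, rightTranslate μ x v⟫_ℂ * ⟪rightTranslate μ x u, u⟫_ℂ ∂μ =
      ∫ g, ⟪v, leftTranslate μ g u⟫_ℂ * ⟪leftTranslate μ g u, v⟫_ℂ ∂μ := by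
  intro u v
  have hinner_u (x h : G) :
      ⟪rightTranslate μ x u, u⟫_ℂ = ∫ g, f (g * h) * star (f (g * h * x)) ∂μ := by
    rw [rightTranslate_toLp, ContinuousMap.inner_toLp, ← integral_mul_right_eq_self _ h]
    rfl
  calc ∫ x, ⟪v, rightTranslate μ x v⟫_ℂ * ⟪rightTranslate μ x u, u⟫_ℂ ∂μ
      = ∫ x, ∫ h, ∫ g, k (h * x) * star (k h) * (f (g * h) * star (f (g * h * x))) ∂μ ∂μ ∂μ := by
        simp_rw [integral_const_mul, ← hinner_u, integral_mul_const]
        simp_rw [v, rightTranslate_toLp, ContinuousMap.inner_toLp]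
        rfl
    _ = ∫ h, ∫ x, ∫ g, k (h * x) * star (k h) * (f (g * h) * star (f (g * h * x))) ∂μ ∂μ ∂μ :=
        integral_swap_of_continuous μ (continuous_integral_of_compactSpace μ (by fun_prop))
    _ = ∫ h, ∫ x, ∫ g, f (g * h) * star (k h) * (k x * star (f (g * x))) ∂μ ∂μ ∂μ := by
        refine integral_congr_ae (.of_forall fun h => ?_)
        simp only
        rw [← integral_mul_left_eq_self _ h⁻¹]
        simp only [mul_inv_cancel_left, mul_assoc, mul_comm, mul_left_comm]
    _ = ∫ h, ∫ g, ∫ x, f (g * h) * star (k h) * (k x * star (f (g * x))) ∂μ ∂μ ∂μ := by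
        congr! 2 with h
        exact integral_swap_of_continuous μ (by fun_prop)
    _ = ∫ g, ∫ h, ∫ x, f (g * h) * star (k h) * (k x * star (f (g * x))) ∂μ ∂μ ∂μ :=
        integral_swap_of_continuous μ (continuous_integral_of_compactSpace μ (by fun_prop))
    _ = ∫ g, ⟪v, leftTranslate μ g u⟫_ℂ * ⟪leftTranslate μ g u, v⟫_ℂ ∂μ := by
        simp_rw [integral_const_mul, integral_mul_const]
        simp_rw [u, v, leftTranslate_toLp, ContinuousMap.inner_toLp]
        rfl

theorem integral_inner_rightTranslate_mul (u v : Lp ℂ 2 μ) :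
    ∫ x, ⟪v, rightTranslate μ x v⟫_ℂ * ⟪rightTranslate μ x u, u⟫_ℂ ∂μ =
      ∫ g, ⟪v, leftTranslate μ g u⟫_ℂ * ⟪leftTranslate μ g u, v⟫_ℂ ∂μ := by
  have hdense : DenseRange (ContinuousMap.toLp 2 μ ℂ : C(G, ℂ) →L[ℂ] Lp ℂ 2 μ) :=
    ContinuousMap.toLp_denseRange ℂ μ ℂ ENNReal.ofNat_ne_top
  have hL := continuous_leftTranslate μ
  have hR := continuous_rightTranslate μ
  refine hdense.induction_on₂ (isClosed_eq ?_ ?_)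
    (integral_inner_rightTranslate_mul_toLp μ) u v
  · refine continuous_integral_of_compactSpace μ (.mul (.inner ?_ ?_) (.inner ?_ ?_))
    · fun_prop
    · exact hR.comp (f := fun y : (Lp ℂ 2 μ × Lp ℂ 2 μ) × G => (y.2, y.1.2)) (by fun_prop)
    · exact hR.comp (f := fun y : (Lp ℂ 2 μ × Lp ℂ 2 μ) × G => (y.2, y.1.1)) (by fun_prop)
    · fun_prop
  · refine continuous_integral_of_compactSpace μ (.mul (.inner ?_ ?_) (.inner ?_ ?_))
    · fun_prop
    · exact hL.comp (f := fun y : (Lp ℂ 2 μ × Lp ℂ 2 μ) × G => (y.2, y.1.1)) (by fun_prop)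
    · exact hL.comp (f := fun y : (Lp ℂ 2 μ × Lp ℂ 2 μ) × G => (y.2, y.1.1)) (by fun_prop)
    · fun_prop

end Plancherel


section MatrixIntegral

variable {X l m n : Type*} [MeasurableSpace X] (μ : Measure X)

/-- The entrywise integral of a matrix-valued function. -/
def matrixIntegral (M : X → Matrix m n ℂ) : Matrix m n ℂ :=
  Matrix.of fun i j => ∫ x, M x i j ∂μ

variable {μ} {M : X → Matrix m n ℂ} (hM : ∀ i j, Integrable (fun x => M x i j) μ)
include hM

theorem mul_matrixIntegral [Fintype m] (A : Matrix l m ℂ) :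
    A * matrixIntegral μ M = matrixIntegral μ fun x => A * M x := by
  ext i j
  simp only [matrixIntegral, Matrix.mul_apply, Matrix.of_apply]
  rw [integral_finsetSum _ fun k _ => (hM k j).const_mul _]
  simp only [integral_const_mul]

theorem matrixIntegral_mul [Fintype n] (A : Matrix n l ℂ) :
    matrixIntegral μ M * A = matrixIntegral μ fun x => M x * A := by
  ext i j
  simp only [matrixIntegral, Matrix.mul_apply, Matrix.of_apply]
  rw [integral_finsetSum _ fun k _ => (hM i k).mul_const _]
  simp only [integral_mul_const]

theorem trace_matrixIntegral_mul [Fintype m] [Fintype n] (A : Matrix n m ℂ) :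
    (matrixIntegral μ M * A).trace = ∫ x, (M x * A).trace ∂μ := by
  have hMA (i : m) : Integrable (fun x => (M x * A) i i) μ := by
    simpa only [Matrix.mul_apply] using integrable_finsetSum _ fun k _ => (hM i k).mul_const (A k i)
  rw [matrixIntegral_mul hM]
  exact (integral_finsetSum _ fun i _ => hMA i).symm

end MatrixIntegral

section Representation

variable {G : Type*} [Group G] [TopologicalSpace G]

theorem IrrRep.mat_mul (π : IrrRep G) (g h : G) : π.mat (g * h) = π.mat g * π.mat h := by
  simp [IrrRep.mat]

theorem IrrRep.mat_one (π : IrrRep G) : π.mat 1 = 1 := by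
  simp [IrrRep.mat]

theorem IrrRep.mat_inv (π : IrrRep G) (g : G) : π.mat g⁻¹ = (π.mat g)ᴴ := by
  simp [IrrRep.mat, Matrix.star_eq_conjTranspose]

theorem IrrRep.continuous_mat (π : IrrRep G) : Continuous π.mat :=
  continuous_subtype_val.comp π.continuous_hom

theorem IrrRep.continuous_conjTranspose_mat_apply (π : IrrRep G) (i j : Fin π.dim) :
    Continuous fun g => (π.mat g)ᴴ i j :=
  π.continuous_mat.matrix_conjTranspose.matrix_elem i j

theorem UnitaryDual.not_equivalent_rep {ξ : UnitaryDual G} {π : IrrRep G} (h : π.cls ≠ ξ) :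
    ¬ ξ.rep.Equivalent π := fun he =>
  h <| calc π.cls = ξ.rep.cls := (Quotient.sound (s := IrrRep.setoid G) he).symm
    _ = ξ := Quotient.out_eq (s := IrrRep.setoid G) ξ

/-- The matrix coefficient `g ↦ trace (π(g) A)`, a typical element of `coeffSpace μ π`. -/
def IrrRep.matrixCoeff (π : IrrRep G) (A : Matrix (Fin π.dim) (Fin π.dim) ℂ) : C(G, ℂ) where
  toFun g := (π.mat g * A).trace
  continuous_toFun := (π.continuous_mat.matrix_mul continuous_const).matrix_trace

theorem IrrRep.eq_zero_of_intertwines {π σ : IrrRep G} (h : ¬ π.Equivalent σ)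
    {A : Matrix (Fin π.dim) (Fin σ.dim) ℂ} (hA : ∀ g, π.mat g * A = A * σ.mat g) : A = 0 := by
  have hA' (g : G) : σ.mat g * Aᴴ = Aᴴ * π.mat g := by
    simpa [Matrix.conjTranspose_mul, IrrRep.mat_inv]
      using (congrArg Matrix.conjTranspose (hA g⁻¹)).symm
  obtain ⟨c, hc⟩ : ∃ c : ℂ, A * Aᴴ = c • 1 := π.irreducible _ fun g => by
    change π.mat g * (A * Aᴴ) = A * Aᴴ * π.mat g
    rw [← Matrix.mul_assoc, hA, Matrix.mul_assoc, hA', Matrix.mul_assoc]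
  obtain ⟨d, hd⟩ : ∃ d : ℂ, Aᴴ * A = d • 1 := σ.irreducible _ fun g => by
    change σ.mat g * (Aᴴ * A) = Aᴴ * A * σ.mat g
    rw [← Matrix.mul_assoc, hA', Matrix.mul_assoc, hA, Matrix.mul_assoc]
  by_contra h0
  have hcd : c = d := by
    refine smul_left_injective ℂ h0 ?_
    calc c • A = A * Aᴴ * A := by rw [hc, Matrix.smul_mul, Matrix.one_mul]
      _ = d • A := by rw [Matrix.mul_assoc, hd, Matrix.mul_smul, Matrix.mul_one]
  have hc0 : c ≠ 0 := by
    rintro rfl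
    rw [zero_smul, Matrix.self_mul_conjTranspose_eq_zero] at hc
    exact h0 hc
  refine h ⟨A, c⁻¹ • Aᴴ, ?_, ?_, hA⟩
  · rw [Matrix.mul_smul, hc, smul_smul, inv_mul_cancel₀ hc0, one_smul]
  · rw [Matrix.smul_mul, hd, ← hcd, smul_smul, inv_mul_cancel₀ hc0, one_smul]

end Representation

section Fourier

variable {G : Type*} [Group G] [TopologicalSpace G] [CompactSpace G]
  [MeasurableSpace G] [BorelSpace G] {μ : Measure G}

theorem integral_mul_trace_conjTranspose_mat {φ : G → ℂ} (hφ : Integrable φ μ) (π : IrrRep G)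
    (A : Matrix (Fin π.dim) (Fin π.dim) ℂ) :
    ∫ g, φ g * ((π.mat g)ᴴ * A).trace ∂μ = (fourierCoeff μ φ π * A).trace := by
  calc ∫ g, φ g * ((π.mat g)ᴴ * A).trace ∂μ = ∫ g, (φ g • (π.mat g)ᴴ * A).trace ∂μ := by
        simp only [Matrix.smul_mul, Matrix.trace_smul, smul_eq_mul]
    _ = (fourierCoeff μ φ π * A).trace := (trace_matrixIntegral_mul (fun i j =>
        integrable_mul_continuous hφ (π.continuous_conjTranspose_mat_apply i j)) A).symm

theorem conv_character {φ : G → ℂ} (hφ : Integrable φ μ) (π : IrrRep G) :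
    conv μ φ π.character = π.matrixCoeff (fourierCoeff μ φ π) := by
  ext g
  simp only [conv, IrrRep.character, IrrRep.mat_mul, IrrRep.mat_inv]
  rw [integral_mul_trace_conjTranspose_mat hφ, Matrix.trace_mul_comm]
  rfl

theorem fourierCoeff_sub {φ ψ : G → ℂ} (hφ : Integrable φ μ) (hψ : Integrable ψ μ)
    (π : IrrRep G) :
    fourierCoeff μ (φ - ψ) π = fourierCoeff μ φ π - fourierCoeff μ ψ π := by
  ext i j
  simp only [fourierCoeff, Matrix.of_apply, Matrix.sub_apply, Pi.sub_apply, sub_mul]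
  exact integral_sub (integrable_mul_continuous hφ (π.continuous_conjTranspose_mat_apply i j))
    (integrable_mul_continuous hψ (π.continuous_conjTranspose_mat_apply i j))

theorem fourierCoeff_sum_smul {ι : Type*} (s : Finset ι) (c : ι → ℂ) {φ : ι → G → ℂ}
    (hφ : ∀ k ∈ s, Integrable (φ k) μ) (π : IrrRep G) :
    fourierCoeff μ (∑ k ∈ s, c k • φ k) π = ∑ k ∈ s, c k • fourierCoeff μ (φ k) π := by
  ext i j
  simp only [fourierCoeff, Matrix.of_apply, Matrix.sum_apply, Matrix.smul_apply, Finset.sum_apply,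
    Pi.smul_apply, Finset.sum_mul, smul_eq_mul, mul_assoc, ← integral_const_mul]
  exact integral_finsetSum _ fun k hk =>
    (integrable_mul_continuous (hφ k hk) (π.continuous_conjTranspose_mat_apply i j)).const_mul _

end Fourier

section Schur

variable {G : Type*} [Group G] [TopologicalSpace G] [CompactSpace G]
  [MeasurableSpace G] [BorelSpace G] (μ : Measure G)

/-- The average `∫ π(g) B σ(g)* dμ(g)`, Schur's way of turning an arbitrary matrix into an
intertwiner. -/
def averagedIntertwiner (π σ : IrrRep G) (B : Matrix (Fin π.dim) (Fin σ.dim) ℂ) :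
    Matrix (Fin π.dim) (Fin σ.dim) ℂ :=
  matrixIntegral μ fun g => π.mat g * B * (σ.mat g)ᴴ

variable [IsFiniteMeasureOnCompacts μ]

theorem integrable_mul_mul_conjTranspose_apply (π σ : IrrRep G)
    (B : Matrix (Fin π.dim) (Fin σ.dim) ℂ) (i : Fin π.dim) (j : Fin σ.dim) :
    Integrable (fun g => (π.mat g * B * (σ.mat g)ᴴ) i j) μ :=
  ((π.continuous_mat.matrix_mul continuous_const).matrix_mul
    σ.continuous_mat.matrix_conjTranspose).matrix_elem i j |>.integrable_of_hasCompactSupport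
    (.of_compactSpace _)

variable [IsTopologicalGroup G] [μ.IsMulLeftInvariant]

theorem mat_mul_averagedIntertwiner (π σ : IrrRep G)
    (B : Matrix (Fin π.dim) (Fin σ.dim) ℂ) (x : G) :
    π.mat x * averagedIntertwiner μ π σ B = averagedIntertwiner μ π σ B * σ.mat x := by
  have hint := integrable_mul_mul_conjTranspose_apply μ π σ B
  rw [averagedIntertwiner, mul_matrixIntegral hint, matrixIntegral_mul hint]
  ext i j
  simp only [matrixIntegral, Matrix.of_apply]
  rw [← integral_mul_left_eq_self (fun g => (π.mat g * B * (σ.mat g)ᴴ * σ.mat x) i j) x]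
  have hunitary : (σ.mat x)ᴴ * σ.mat x = 1 := by
    rw [← IrrRep.mat_inv, ← IrrRep.mat_mul, inv_mul_cancel, IrrRep.mat_one]
  simp only [IrrRep.mat_mul, Matrix.conjTranspose_mul, Matrix.mul_assoc, hunitary, Matrix.mul_one]

theorem fourierCoeff_matrixCoeff_of_not_equivalent {π σ : IrrRep G}
    (h : ¬ σ.Equivalent π) (B : Matrix (Fin σ.dim) (Fin σ.dim) ℂ) :
    fourierCoeff μ (σ.matrixCoeff B) π = 0 := by
  ext i j
  let E (a : Fin σ.dim) : Matrix (Fin σ.dim) (Fin π.dim) ℂ := Matrix.single a i 1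
  have hentry (g : G) : σ.matrixCoeff B g * (π.mat g)ᴴ i j =
      ∑ a, (σ.mat g * (B * E a) * (π.mat g)ᴴ) a j := by
    have hdiag (a : Fin σ.dim) : (σ.mat g * (B * E a) * (π.mat g)ᴴ) a j =
        (σ.mat g * B) a a * (π.mat g)ᴴ i j := by
      rw [← Matrix.mul_assoc, Matrix.mul_apply, Finset.sum_eq_single i]
      · rw [Matrix.mul_single_apply_same, mul_one]
      · intro k _ hk
        rw [Matrix.mul_single_apply_of_ne (hbj := hk), zero_mul]
      · simp
    simp only [hdiag, ← Finset.sum_mul]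
    rfl
  calc fourierCoeff μ (σ.matrixCoeff B) π i j
      = ∫ g, ∑ a, (σ.mat g * (B * E a) * (π.mat g)ᴴ) a j ∂μ := by
        simp only [fourierCoeff, Matrix.of_apply, hentry]
    _ = ∑ a, averagedIntertwiner μ σ π (B * E a) a j :=
        integral_finsetSum _ fun a _ => integrable_mul_mul_conjTranspose_apply μ σ π _ a j
    _ = 0 := Finset.sum_eq_zero fun a _ => by
        rw [IrrRep.eq_zero_of_intertwines h (mat_mul_averagedIntertwiner μ σ π _),
          Matrix.zero_apply]

end Schur

section Restriction

variable {G : Type*} [Group G] [TopologicalSpace G] [CompactSpace G]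
  [MeasurableSpace G] [BorelSpace G] {μ : Measure G} {S : Set (UnitaryDual G)} {φ : G → ℂ}

theorem restrictTo_eq_sub_sum (hS : Sᶜ.Finite) (hφ : Integrable φ μ) :
    restrictTo μ S φ = φ - ∑ ξ ∈ hS.toFinset,
      (ξ.rep.dim : ℂ) • ⇑(ξ.rep.matrixCoeff (fourierCoeff μ φ ξ.rep)) := by
  ext g
  simp only [restrictTo, finsum_mem_eq_finite_toFinset_sum _ hS, conv_character hφ,
    Pi.sub_apply, Finset.sum_apply, Pi.smul_apply, smul_eq_mul]

theorem integrable_matrixCoeff [IsFiniteMeasureOnCompacts μ] (π : IrrRep G)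
    (A : Matrix (Fin π.dim) (Fin π.dim) ℂ) : Integrable (π.matrixCoeff A) μ :=
  (map_continuous _).integrable_of_hasCompactSupport (.of_compactSpace _)

theorem integrable_restrictTo [IsFiniteMeasureOnCompacts μ] (hS : Sᶜ.Finite)
    (hφ : Integrable φ μ) : Integrable (restrictTo μ S φ) μ := by
  rw [restrictTo_eq_sub_sum hS hφ]
  exact hφ.sub (integrable_finsetSum' _ fun ξ _ => (integrable_matrixCoeff _ _).smul _)

theorem fourierCoeff_restrictTo [IsTopologicalGroup G] [IsFiniteMeasureOnCompacts μ]
    [μ.IsMulLeftInvariant] (hS : Sᶜ.Finite) (hφ : Integrable φ μ) {π : IrrRep G} (hπ : π.cls ∈ S) :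
    fourierCoeff μ (restrictTo μ S φ) π = fourierCoeff μ φ π := by
  have hnot (ξ : UnitaryDual G) (hξ : ξ ∈ hS.toFinset) : ¬ ξ.rep.Equivalent π :=
    UnitaryDual.not_equivalent_rep fun h => hS.mem_toFinset.mp hξ (h ▸ hπ)
  rw [restrictTo_eq_sub_sum hS hφ, fourierCoeff_sub hφ
      (integrable_finsetSum' _ fun ξ _ => (integrable_matrixCoeff _ _).smul _),
    fourierCoeff_sum_smul _ _ fun ξ _ => integrable_matrixCoeff _ _,
    Finset.sum_eq_zero fun ξ hξ => ?_, sub_zero]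
  rw [fourierCoeff_matrixCoeff_of_not_equivalent μ (hnot ξ hξ), smul_zero]

end Restriction

section ApproximateIdentity

variable {G : Type*} [Group G] [TopologicalSpace G] [IsTopologicalGroup G] [CompactSpace G]
  [MeasurableSpace G] [BorelSpace G] (μ : Measure G) [μ.IsHaarMeasure]

theorem exists_inner_rightTranslate_eq_trace {π : IrrRep G} {v : Lp ℂ 2 μ}
    (hv : v ∈ coeffSpace μ π) (u : Lp ℂ 2 μ) :
    ∃ B, ∀ g, ⟪rightTranslate μ g v, u⟫_ℂ = ((π.mat g)ᴴ * B).trace := by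
  obtain ⟨A, hA⟩ := hv
  refine ⟨fourierCoeff μ u π * Aᴴ, fun g => ?_⟩
  have hu : Integrable u μ := (Lp.memLp u).integrable one_le_two
  have hRv : rightTranslate μ g v =ᵐ[μ] fun h => (π.mat (h * g) * A).trace :=
    (rightTranslate_ae_eq μ g v).trans
      ((measurePreserving_mul_right μ g).quasiMeasurePreserving.ae_eq_comp hA)
  calc ⟪rightTranslate μ g v, u⟫_ℂ = ∫ h, u h * ((π.mat h)ᴴ * (Aᴴ * (π.mat g)ᴴ)).trace ∂μ := by
        rw [L2.inner_def]
        refine integral_congr_ae ?_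
        filter_upwards [hRv] with h hh
        rw [hh, RCLike.inner_apply, IrrRep.mat_mul, starRingEnd_apply, ← Matrix.trace_conjTranspose]
        simp only [Matrix.conjTranspose_mul]
        rw [← Matrix.mul_assoc, Matrix.trace_mul_comm]
    _ = (fourierCoeff μ u π * (Aᴴ * (π.mat g)ᴴ)).trace :=
        integral_mul_trace_conjTranspose_mat hu π _
    _ = ((π.mat g)ᴴ * (fourierCoeff μ u π * Aᴴ)).trace := by
        rw [← Matrix.mul_assoc, Matrix.trace_mul_comm]

theorem continuous_inner_rightTranslate (v u : Lp ℂ 2 μ) :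
    Continuous fun x : G => ⟪rightTranslate μ x v, u⟫_ℂ :=
  ((continuous_rightTranslate μ).comp (Continuous.prodMk_left v)).inner continuous_const

theorem tendsto_integral_mul_inner_rightTranslate {ι : Type*} {l : Filter ι} {q : ι → G → ℂ}
    {S : Set (UnitaryDual G)} (hq : ∀ᶠ t in l, Integrable (q t) μ)
    (hlim : ∀ π : IrrRep G, π.cls ∈ S → Tendsto (fun t => fourierCoeff μ (q t) π) l (𝓝 1))
    {v : Lp ℂ 2 μ} (hv : v ∈ ⨆ π : {π : IrrRep G // π.cls ∈ S}, coeffSpace μ π.1)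
    (u : Lp ℂ 2 μ) :
    Tendsto (fun t => ∫ g, q t g * ⟪rightTranslate μ g v, u⟫_ℂ ∂μ) l (𝓝 ⟪v, u⟫_ℂ) := by
  induction hv using Submodule.iSup_induction' with
  | mem π v hv =>
    obtain ⟨B, hB⟩ := exists_inner_rightTranslate_eq_trace μ hv u
    have htrace : ⟪v, u⟫_ℂ = (1 * B).trace := by
      rw [← rightTranslate_one μ v, hB, IrrRep.mat_one, Matrix.conjTranspose_one]
    rw [htrace]
    have hcts : Continuous fun A => (A * B).trace :=
      (continuous_id.matrix_mul continuous_const).matrix_trace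
    refine ((hcts.tendsto 1).comp (hlim π π.2)).congr' ?_
    filter_upwards [hq] with t ht
    simp only [hB, integral_mul_trace_conjTranspose_mat ht, Function.comp_apply]
  | zero => simpa only [map_zero, inner_zero_left, mul_zero, integral_zero] using tendsto_const_nhds
  | add v w _ _ ihv ihw =>
    rw [inner_add_left]
    refine (ihv.add ihw).congr' ?_
    filter_upwards [hq] with t ht
    simp only [map_add, inner_add_left, mul_add]
    exact (integral_add
      (integrable_mul_continuous ht (continuous_inner_rightTranslate μ v u))
      (integrable_mul_continuous ht (continuous_inner_rightTranslate μ w u))).symm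

end ApproximateIdentity


section IsometricExtension

variable {𝕜 H X F : Type*} [NormedField 𝕜] [NormedAddCommGroup H] [NormedSpace 𝕜 H]
  [MeasurableSpace X] {ν : Measure X} [NormedAddCommGroup F] [NormedSpace 𝕜 F] {p : ℝ≥0∞}

theorem eLpNorm_le_enorm_of_mem_closure {T : H → X → F} (hcont : ∀ x, Continuous (T · x))
    (hmeas : ∀ u, AEStronglyMeasurable (T u) ν) {s : Set H}
    (hs : ∀ v ∈ s, eLpNorm (T v) p ν ≤ ‖v‖ₑ) {u : H} (hu : u ∈ closure s) :
    eLpNorm (T u) p ν ≤ ‖u‖ₑ := by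
  obtain ⟨v, hvs, hv⟩ := mem_closure_iff_seq_limit.1 hu
  have henorm : Tendsto (fun n => ‖v n‖ₑ) atTop (𝓝 ‖u‖ₑ) := (continuous_enorm.tendsto u).comp hv
  calc eLpNorm (T u) p ν ≤ liminf (fun n => eLpNorm (T (v n)) p ν) atTop :=
        Lp.eLpNorm_lim_le_liminf_eLpNorm (fun n => hmeas (v n)) _
          (.of_forall fun x => ((hcont x).tendsto u).comp hv)
    _ ≤ liminf (fun n => ‖v n‖ₑ) atTop := liminf_le_liminf (.of_forall fun n => hs _ (hvs n))
    _ = ‖u‖ₑ := henorm.liminf_eq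

theorem eLpNorm_eq_enorm_of_mem_topologicalClosure (hp : 1 ≤ p) {T : H →ₗ[𝕜] X → F}
    (hcont : ∀ x, Continuous (T · x)) (hmeas : ∀ u, AEStronglyMeasurable (T u) ν)
    {V : Submodule 𝕜 H} (hV : ∀ v ∈ V, eLpNorm (T v) p ν = ‖v‖ₑ) {u : H}
    (hu : u ∈ V.topologicalClosure) : eLpNorm (T u) p ν = ‖u‖ₑ := by
  have hle {w : H} (hw : w ∈ V.topologicalClosure) : eLpNorm (T w) p ν ≤ ‖w‖ₑ :=
    eLpNorm_le_enorm_of_mem_closure hcont hmeas (fun v hv => (hV v hv).le) hw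
  refine (hle hu).antisymm ?_
  obtain ⟨v, hvV, hv⟩ := mem_closure_iff_seq_limit.1 hu
  have hbound (n : ℕ) : ‖v n‖ₑ ≤ eLpNorm (T u) p ν + ‖v n - u‖ₑ :=
    calc ‖v n‖ₑ = eLpNorm (T u + T (v n - u)) p ν := by
          rw [← map_add, add_sub_cancel, hV _ (hvV n)]
      _ ≤ eLpNorm (T u) p ν + eLpNorm (T (v n - u)) p ν :=
          eLpNorm_add_le (hmeas _) (hmeas _) hp
      _ ≤ eLpNorm (T u) p ν + ‖v n - u‖ₑ := by
          gcongr
          exact hle (sub_mem (V.le_topologicalClosure (hvV n)) hu)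
  have hdiff : Tendsto (fun n => eLpNorm (T u) p ν + ‖v n - u‖ₑ) atTop
      (𝓝 (eLpNorm (T u) p ν + ‖u - u‖ₑ)) :=
    tendsto_const_nhds.add ((continuous_enorm.tendsto _).comp (hv.sub_const u))
  rw [sub_self, enorm_zero, add_zero] at hdiff
  exact le_of_tendsto_of_tendsto' ((continuous_enorm.tendsto u).comp hv) hdiff hbound

theorem exists_linearIsometry_ae_eq [Fact (1 ≤ p)] (T : H →ₗ[𝕜] X → F) {V : Submodule 𝕜 H}
    (hmeas : ∀ v ∈ V, AEStronglyMeasurable (T v) ν)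
    (hV : ∀ v ∈ V, eLpNorm (T v) p ν = ‖v‖ₑ) :
    ∃ W : V →ₗᵢ[𝕜] Lp F p ν, ∀ v : V, W v =ᵐ[ν] T v := by
  have hmem (v : V) : MemLp (T v) p ν :=
    ⟨hmeas v v.2, (hV v v.2).trans_lt enorm_lt_top⟩
  let W : V →ₗ[𝕜] Lp F p ν :=
    { toFun := fun v => (hmem v).toLp
      map_add' := fun v w => by simp only [← MemLp.toLp_add, Submodule.coe_add, map_add]
      map_smul' := fun c v => by
        simp only [← MemLp.toLp_const_smul, Submodule.coe_smul, map_smul, RingHom.id_apply] }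
  have hW (v : V) : ‖W v‖ = ‖v‖ := by
    change ‖(hmem v).toLp‖ = ‖(v : H)‖
    rw [Lp.norm_toLp, hV v v.2, toReal_enorm]
  exact ⟨⟨W, hW⟩, fun v => (hmem v).coeFn_toLp⟩

end IsometricExtension

section ImproperIntegral

theorem setLIntegral_Ioi_ofReal_of_tendsto {f : ℝ → ℝ} {t c : ℝ} (hf : ∀ ρ, t < ρ → 0 ≤ f ρ)
    (hint : ∀ T, t < T → IntervalIntegrable f volume t T)
    (hlim : Tendsto (fun T => ∫ ρ in t..T, f ρ) atTop (𝓝 c)) :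
    ∫⁻ ρ in Ioi t, ENNReal.ofReal (f ρ) = ENNReal.ofReal c := by
  have hIoc (T : ℝ) : IntegrableOn f (Ioc t T) := by
    rcases lt_or_ge t T with hT | hT
    · exact (intervalIntegrable_iff_integrableOn_Ioc_of_le hT.le).1 (hint T hT)
    · simp [Ioc_eq_empty_of_le hT]
  have hnorm : Tendsto (fun T => ∫ ρ in t..T, ‖f ρ‖) atTop (𝓝 c) := by
    refine hlim.congr' ?_
    filter_upwards [eventually_gt_atTop t] with T hT
    refine intervalIntegral.integral_congr_ae (.of_forall fun ρ hρ => ?_)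
    rw [uIoc_of_le hT.le] at hρ
    exact (Real.norm_of_nonneg (hf ρ hρ.1)).symm
  have hIoi : IntegrableOn f (Ioi t) :=
    integrableOn_Ioi_of_intervalIntegral_norm_tendsto c t hIoc tendsto_id hnorm
  rw [← ofReal_integral_eq_lintegral_ofReal hIoi
      ((ae_restrict_mem measurableSet_Ioi).mono hf),
    tendsto_nhds_unique (intervalIntegral_tendsto_integral_Ioi t hIoi tendsto_id) hlim]

theorem setLIntegral_Ioi_of_tendsto {f F : ℝ → ℝ≥0∞} {a : ℝ} {c : ℝ≥0∞}
    (hf : AEMeasurable f (volume.restrict (Ioi a)))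
    (hF : ∀ t, a < t → ∫⁻ ρ in Ioi t, f ρ = F t) (hlim : Tendsto F (𝓝[>] a) (𝓝 c)) :
    ∫⁻ ρ in Ioi a, f ρ = c := by
  have hcover : AECover (volume.restrict (Ioi a)) (𝓝[>] a) Ioi :=
    aecover_Ioi_of_Ioi (tendsto_id.mono_left nhdsWithin_le_nhds)
  refine hcover.lintegral_eq_of_tendsto _ hf (hlim.congr' ?_)
  filter_upwards [self_mem_nhdsWithin] with t (ht : a < t)
  rw [Measure.restrict_restrict measurableSet_Ioi, inter_eq_left.2 (Ioi_subset_Ioi ht.le), hF t ht]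

end ImproperIntegral

section Transform

variable {G : Type*} [Group G] [MeasurableSpace G] [MeasurableMul G] (μ : Measure G)
  [μ.IsMulLeftInvariant]

/-- The squared `L²(G)` norm of the wavelet transform of `u` at a scale with wavelet `v`. -/
def energy (u v : Lp ℂ 2 μ) : ℝ := ∫ g, ‖⟪v, leftTranslate μ g u⟫_ℂ‖ ^ 2 ∂μ

theorem energy_nonneg (u v : Lp ℂ 2 μ) : 0 ≤ energy μ u v :=
  integral_nonneg fun _ => by positivity

/-- The wavelet transform as a linear map from `L²(G)` to functions on `ℝ × G`. -/
def waveletTransformₗ (ψ : ℝ → Lp ℂ 2 μ) : Lp ℂ 2 μ →ₗ[ℂ] ℝ × G → ℂ where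
  toFun φ := waveletTransform μ ψ φ
  map_add' φ₁ φ₂ := by
    ext y
    simp only [waveletTransform_eq_inner, map_add, inner_add_right, Pi.add_apply]
  map_smul' c φ := by
    ext y
    simp only [waveletTransform_eq_inner, map_smul, inner_smul_right, RingHom.id_apply,
      Pi.smul_apply, smul_eq_mul]

theorem continuous_waveletTransformₗ_apply (ψ : ℝ → Lp ℂ 2 μ) (y : ℝ × G) :
    Continuous fun φ => waveletTransformₗ μ ψ φ y := by
  refine Continuous.congr ?_ fun φ => (waveletTransform_eq_inner μ ψ φ y).symm
  exact continuous_const.inner (leftTranslate μ y.2).continuous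

end Transform

section Isometry

variable {G : Type*} [Group G] [TopologicalSpace G] [IsTopologicalGroup G] [CompactSpace G]
  [MeasurableSpace G] [BorelSpace G] (μ : Measure G) [μ.IsHaarMeasure]

/-- The admissibility condition `q_t = ∫_t^∞ ψ̌_ρ * ψ_ρ α(ρ) dρ`, `t > 0`, in the weak sense of
`IsDiffusiveWaveletFamily.admissible`, for an arbitrary family of functions `q_t` in place of the
projections `p_t|_S`. -/
def IsWeaklyAdmissible (q : ℝ → G → ℂ) (α : ℝ → ℝ) (ψ : ℝ → Lp ℂ 2 μ) : Prop :=
  ∀ t : ℝ, 0 < t → ∀ f : C(G, ℂ),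
    (∀ T, t < T → IntervalIntegrable
      (fun ρ => (∫ g, conv μ (invol (ψ ρ)) (ψ ρ) g * f g ∂μ) * (α ρ : ℂ)) volume t T) ∧
    Tendsto (fun T => ∫ ρ in t..T, (∫ g, conv μ (invol (ψ ρ)) (ψ ρ) g * f g ∂μ) * (α ρ : ℂ))
      atTop (𝓝 (∫ g, q t g * f g ∂μ))

theorem continuous_inner_leftTranslate (u : Lp ℂ 2 μ) :
    Continuous fun y : Lp ℂ 2 μ × G => ⟪y.1, leftTranslate μ y.2 u⟫_ℂ :=
  continuous_fst.inner
    ((continuous_leftTranslate μ).comp (f := fun y : Lp ℂ 2 μ × G => (y.2, u)) (by fun_prop))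

theorem continuous_energy (u : Lp ℂ 2 μ) : Continuous (energy μ u) :=
  continuous_integral_of_compactSpace μ ((continuous_inner_leftTranslate μ u).norm.pow 2)

theorem lintegral_enorm_sq_inner_leftTranslate (u v : Lp ℂ 2 μ) :
    ∫⁻ g, ‖⟪v, leftTranslate μ g u⟫_ℂ‖ₑ ^ 2 ∂μ = ENNReal.ofReal (energy μ u v) := by
  have hcont : Continuous fun g : G => ‖⟪v, leftTranslate μ g u⟫_ℂ‖ ^ 2 :=
    ((continuous_inner_leftTranslate μ u).comp (Continuous.prodMk_right v)).norm.pow 2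
  rw [energy, ofReal_integral_eq_lintegral_ofReal
    (hcont.integrable_of_hasCompactSupport (.of_compactSpace _))
    (.of_forall fun _ => by positivity)]
  simp [ENNReal.ofReal_pow]

theorem integral_conv_invol_mul_inner_rightTranslate (u v : Lp ℂ 2 μ) :
    ∫ x, conv μ (invol v) v x * ⟪rightTranslate μ x u, u⟫_ℂ ∂μ = energy μ u v := by
  calc ∫ x, conv μ (invol v) v x * ⟪rightTranslate μ x u, u⟫_ℂ ∂μ
      = ∫ g, ⟪v, leftTranslate μ g u⟫_ℂ * ⟪leftTranslate μ g u, v⟫_ℂ ∂μ := by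
        simp only [conv_invol_eq_inner, integral_inner_rightTranslate_mul]
    _ = ∫ g, ((‖⟪v, leftTranslate μ g u⟫_ℂ‖ ^ 2 : ℝ) : ℂ) ∂μ := by
        congr! 2 with g
        rw [← inner_conj_symm _ v, Complex.mul_conj']
        norm_cast
    _ = energy μ u v := integral_complex_ofReal

variable {μ} {S : Set (UnitaryDual G)} {q : ℝ → G → ℂ} {α : ℝ → ℝ} {ψ : ℝ → Lp ℂ 2 μ}

theorem IsWeaklyAdmissible.setLIntegral_energy_Ioi (hψ : IsWeaklyAdmissible μ q α ψ)
    (hα : ∀ ρ, 0 < ρ → 0 ≤ α ρ) (u : Lp ℂ 2 μ) {t : ℝ} (ht : 0 < t) :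
    ∫⁻ ρ in Ioi t, ENNReal.ofReal (energy μ u (ψ ρ) * α ρ) =
      ENNReal.ofReal (∫ g, q t g * ⟪rightTranslate μ g u, u⟫_ℂ ∂μ).re := by
  obtain ⟨hint, hlim⟩ := hψ t ht ⟨_, continuous_inner_rightTranslate μ u u⟩
  simp only [ContinuousMap.coe_mk, integral_conv_invol_mul_inner_rightTranslate,
    ← Complex.ofReal_mul] at hint hlim
  refine setLIntegral_Ioi_ofReal_of_tendsto
    (fun ρ hρ => mul_nonneg (energy_nonneg μ u _) (hα ρ (ht.trans hρ))) (fun T hT => ?_) ?_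
  · simpa [intervalIntegrable_iff, IntegrableOn] using
      (intervalIntegrable_iff.1 (hint T hT)).re
  · simpa only [Function.comp_def, intervalIntegral.integral_ofReal, Complex.ofReal_re] using
      (Complex.continuous_re.tendsto _).comp hlim

theorem IsWeaklyAdmissible.setLIntegral_energy (hψ : IsWeaklyAdmissible μ q α ψ)
    (hq : ∀ t, 0 < t → Integrable (q t) μ)
    (hlim : ∀ π : IrrRep G, π.cls ∈ S →
      Tendsto (fun t => fourierCoeff μ (q t) π) (𝓝[>] 0) (𝓝 1))
    (hα : ∀ ρ, 0 < ρ → 0 ≤ α ρ) (hα_meas : AEMeasurable α (volume.restrict (Ioi 0)))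
    (hψ_meas : AEStronglyMeasurable ψ (volume.restrict (Ioi 0))) {u : Lp ℂ 2 μ}
    (hu : u ∈ ⨆ π : {π : IrrRep G // π.cls ∈ S}, coeffSpace μ π.1) :
    ∫⁻ ρ in Ioi 0, ENNReal.ofReal (energy μ u (ψ ρ) * α ρ) = ‖u‖ₑ ^ 2 := by
  have hlim_inner : Tendsto (fun t => ∫ g, q t g * ⟪rightTranslate μ g u, u⟫_ℂ ∂μ) (𝓝[>] 0)
      (𝓝 ⟪u, u⟫_ℂ) :=
    tendsto_integral_mul_inner_rightTranslate μ (eventually_mem_nhdsWithin.mono hq) hlim hu u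
  have henergy : AEMeasurable (fun ρ => energy μ u (ψ ρ)) (volume.restrict (Ioi 0)) :=
    ((continuous_energy μ u).comp_aestronglyMeasurable hψ_meas).aemeasurable
  refine setLIntegral_Ioi_of_tendsto (henergy.mul hα_meas).ennreal_ofReal
    (fun t ht => hψ.setLIntegral_energy_Ioi hα u ht) ?_
  have hnorm : ENNReal.ofReal (⟪u, u⟫_ℂ).re = ‖u‖ₑ ^ 2 := by
    rw [← ofReal_norm, ← ENNReal.ofReal_pow (norm_nonneg u), ← inner_self_eq_norm_sq (𝕜 := ℂ)]
    rfl
  rw [← hnorm]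
  exact ((ENNReal.continuous_ofReal.comp Complex.continuous_re).tendsto _).comp hlim_inner

instance sigmaFinite_scaleMeasure (α : ℝ → ℝ) : SigmaFinite (scaleMeasure α) := by
  unfold scaleMeasure
  infer_instance

theorem aestronglyMeasurable_waveletTransform
    (hψ : AEStronglyMeasurable ψ (volume.restrict (Ioi 0))) (u : Lp ℂ 2 μ) :
    AEStronglyMeasurable (waveletTransform μ ψ u) ((scaleMeasure α).prod μ) := by
  rw [funext (waveletTransform_eq_inner μ ψ u)]
  have hscale : AEStronglyMeasurable ψ (scaleMeasure α) :=
    hψ.mono_ac (withDensity_absolutelyContinuous _ _)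
  have htranslate : AEStronglyMeasurable (fun g => leftTranslate μ g u) μ :=
    ((continuous_leftTranslate μ).comp (Continuous.prodMk_left u))
      |>.aestronglyMeasurable_of_compactSpace
  exact hscale.comp_fst.inner htranslate.comp_snd

theorem eLpNorm_waveletTransform_sq (hα : AEMeasurable α (volume.restrict (Ioi 0)))
    (hψ : AEStronglyMeasurable ψ (volume.restrict (Ioi 0))) (u : Lp ℂ 2 μ) :
    eLpNorm (waveletTransform μ ψ u) 2 ((scaleMeasure α).prod μ) ^ 2 =
      ∫⁻ ρ in Ioi 0, ENNReal.ofReal (energy μ u (ψ ρ) * α ρ) := by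
  have hmeas : AEStronglyMeasurable (waveletTransform μ ψ u) ((scaleMeasure α).prod μ) :=
    aestronglyMeasurable_waveletTransform hψ u
  have henergy : AEMeasurable (fun ρ => ENNReal.ofReal (energy μ u (ψ ρ)))
      (volume.restrict (Ioi 0)) :=
    ((continuous_energy μ u).comp_aestronglyMeasurable hψ).aemeasurable.ennreal_ofReal
  calc eLpNorm (waveletTransform μ ψ u) 2 ((scaleMeasure α).prod μ) ^ 2
      = ∫⁻ y, ‖waveletTransform μ ψ u y‖ₑ ^ 2 ∂(scaleMeasure α).prod μ := by
        simpa using eLpNorm_nnreal_pow_eq_lintegral (p := 2) two_ne_zero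
    _ = ∫⁻ ρ, ENNReal.ofReal (energy μ u (ψ ρ)) ∂scaleMeasure α := by
        rw [lintegral_prod _ (hmeas.enorm.pow_const 2)]
        simp only [waveletTransform_eq_inner, lintegral_enorm_sq_inner_leftTranslate]
    _ = ∫⁻ ρ in Ioi 0, ENNReal.ofReal (energy μ u (ψ ρ) * α ρ) := by
        rw [scaleMeasure, lintegral_withDensity_eq_lintegral_mul₀ hα.ennreal_ofReal henergy]
        simp only [Pi.mul_apply, mul_comm (ENNReal.ofReal (α _)),
          ENNReal.ofReal_mul (energy_nonneg μ u _)]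

end Isometry

end DiffusiveWavelet

end

theorem theorem3p3_general
    {G : Type*} [Group G] [TopologicalSpace G] [IsTopologicalGroup G] [CompactSpace G]
    [MeasurableSpace G] [BorelSpace G] {μ : Measure G} [μ.IsHaarMeasure]
    {S : Set (UnitaryDual G)} {q : ℝ → G → ℂ} (hq : ∀ t, 0 < t → Integrable (q t) μ)
    (hlim : ∀ π : IrrRep G, π.cls ∈ S →
      Tendsto (fun t => fourierCoeff μ (q t) π) (𝓝[>] 0) (𝓝 1))
    {α : ℝ → ℝ} (hα : ∀ ρ, 0 < ρ → 0 ≤ α ρ)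
    (hα_meas : AEMeasurable α (volume.restrict (Ioi 0)))
    {ψ : ℝ → Lp ℂ 2 μ} (hψ_meas : AEStronglyMeasurable ψ (volume.restrict (Ioi 0)))
    (hψ : IsWeaklyAdmissible μ q α ψ) :
    ∃ W : L2Zero μ S →ₗᵢ[ℂ] Lp ℂ 2 ((scaleMeasure α).prod μ), ∀ φ : L2Zero μ S,
      W φ =ᵐ[(scaleMeasure α).prod μ] waveletTransform μ ψ (φ : Lp ℂ 2 μ) := by
  have hmeas (u : Lp ℂ 2 μ) :
      AEStronglyMeasurable (waveletTransformₗ μ ψ u) ((scaleMeasure α).prod μ) :=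
    aestronglyMeasurable_waveletTransform hψ_meas u
  have hspan (u : Lp ℂ 2 μ) (hu : u ∈ ⨆ π : {π : IrrRep G // π.cls ∈ S}, coeffSpace μ π.1) :
      eLpNorm (waveletTransformₗ μ ψ u) 2 ((scaleMeasure α).prod μ) = ‖u‖ₑ :=
    (ENNReal.pow_right_strictMono two_ne_zero).injective <|
      (eLpNorm_waveletTransform_sq hα_meas hψ_meas u).trans
        (hψ.setLIntegral_energy hq hlim hα hα_meas hψ_meas hu)
  exact exists_linearIsometry_ae_eq (waveletTransformₗ μ ψ) (fun u _ => hmeas u) fun u hu =>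
    eLpNorm_eq_enorm_of_mem_topologicalClosure one_le_two
      (continuous_waveletTransformₗ_apply μ ψ) hmeas hspan hu

theorem theorem3p3
    {E : Type*} [NormedAddCommGroup E] [NormedSpace ℝ E] [FiniteDimensional ℝ E]
    {G : Type*} [Group G] [TopologicalSpace G] [IsTopologicalGroup G] [T2Space G] [CompactSpace G]
    [ChartedSpace E G] [LieGroup 𝓘(ℝ, E) ∞ G]
    [MeasurableSpace G] [BorelSpace G]
    (μ : Measure G) [μ.IsHaarMeasure] [IsProbabilityMeasure μ]
    (S : Set (UnitaryDual G)) (p : ℝ → Lp ℂ 1 μ)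
    (hp : IsDiffusiveApproximateIdentity μ S p)
    (α : ℝ → ℝ) (ψ : ℝ → Lp ℂ 2 μ)
    (hψ : IsDiffusiveWaveletFamily μ S p α ψ) :
    ∃ W : L2Zero μ S →ₗ[ℂ] Lp ℂ 2 ((scaleMeasure α).prod μ),
      (∀ φ : L2Zero μ S,
        (W φ : ℝ × G → ℂ) =ᵐ[(scaleMeasure α).prod μ]
          waveletTransform μ ψ (φ : Lp ℂ 2 μ)) ∧
      (∀ φ₁ φ₂ : L2Zero μ S, ⟪W φ₁, W φ₂⟫_ℂ = ⟪φ₁, φ₂⟫_ℂ) := by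
  have hint (t : ℝ) : Integrable (p t) μ := L1.integrable_coeFn (p t)
  obtain ⟨W, hW⟩ := theorem3p3_general (q := fun t => restrictTo μ S (p t))
    (fun t _ => integrable_restrictTo hp.cofinite (hint t))
    (fun π hπ => (hp.tendsto_one π).congr fun t =>
      (fourierCoeff_restrictTo hp.cofinite (hint t) hπ).symm)
    (fun ρ hρ => (hψ.weight_pos ρ hρ).le) hψ.weight_measurable hψ.measurable hψ.admissible
  exact ⟨W.toLinearMap, hW, W.inner_map_map⟩
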